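/- Let $G$ be a finite group with exactly $n$ conjugacy classes, let $\rho_1,\ldots,\rho_n$ be, up to isomorphism, its distinct irreducible complex representations, with characters $\chi_1,\ldots,\chi_n$, and let $g_1=e_G,g_2,\ldots,g_n$ be representatives of its distinct conjugacy classes. Suppose that the character table $Q=[\chi_i(g_j)]_{i,j=1}^n$ has only real entries, and regard it as a real matrix. For an invertible real $n\times n$ matrix $S$ and $x\in\mathbb{R}^n$ let $D_x$ be the diagonal matrix with diagonal $x$ and $M_x(S)=SD_xS^{-1}$. The (Perron) spectratope of $S$ is $$\mathcal{P}(S)=\{x\in\mathbb{R}^n \mid M_x(S)\geqslant 0 \text{ entrywise and } M_x(S)e=e\},$$ where $e$ is the all-ones vector. Let $v=Qe_1$ be the first column of $Q$ (so $v_k=\dim\rho_k$), let $v^{-1}$ be its entrywise inverse, and let $\Pi_1:\mathbb{R}^n\to\mathbb{R}^{n-1}$ be the projection that deletes the first coordinate. Then $\Pi_1(\mathcal{P}(D_{v^{-1}}Q))$ is an $(n-1)$-simplex in $\mathbb{R}^{n-1}$ (the convex hull of $n$ affinely independent points), and its volume ($(n-1)$-dimensional Lebesgue measure) is $$V=\frac{\sqrt{\prod_{k=1}^n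 |C_G(g_k)|}}{(n-1)!\,\prod_{k=1}^n\dim(\rho_k)},$$ where $C_G(g)$ denotes the centralizer of $g$ in $G$. -/

import Mathlib

open scoped ComplexOrder

noncomputable section

/-- `M_x(S) = S D_x S⁻¹`. -/
def spectralMatrix {n : ℕ} {𝕜 : Type*} [RCLike 𝕜] (S : Matrix (Fin n) (Fin n) 𝕜)
    (x : Fin n → 𝕜) : Matrix (Fin n) (Fin n) 𝕜 :=
  S * Matrix.diagonal x * S⁻¹

/-- The (Perron) spectracone of an invertible matrix `S` over `𝕜 = ℝ` or `ℂ`: all `x` for which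
`M_x(S)` is entrywise nonnegative (over `ℂ`, `0 ≤ z` means that `z` is real and nonnegative). -/
def spectracone {n : ℕ} {𝕜 : Type*} [RCLike 𝕜] (S : Matrix (Fin n) (Fin n) 𝕜) :
    Set (Fin n → 𝕜) :=
  {x | ∀ i j, 0 ≤ spectralMatrix S x i j}

/-- The (Perron) spectratope of an invertible matrix `S`: all `x` in the spectracone for which
`M_x(S) e = e`, where `e` is the all-ones vector. -/
def spectratope {n : ℕ} {𝕜 : Type*} [RCLike 𝕜] (S : Matrix (Fin n) (Fin n) 𝕜) :
    Set (Fin n → 𝕜) :=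
  {x | x ∈ spectracone S ∧ (spectralMatrix S x).mulVec 1 = 1}

/-- The projection `Π_k : 𝕜^(m+1) → 𝕜^m` that deletes the `k`-th coordinate. -/
def deleteCoord {m : ℕ} {𝕜 : Type*} (k : Fin (m + 1)) (x : Fin (m + 1) → 𝕜) : Fin m → 𝕜 :=
  fun i => x (k.succAbove i)

/-- `ρ₁, …, ρₙ` are, up to isomorphism, the distinct irreducible complex (matrix) representations
of `G`: each is irreducible, no two are isomorphic, and every irreducible one is isomorphic to one
of them. The representation `ρ k` acts on `ℂ^(d k)`, so `d k` is its dimension. -/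
structure IsIrrepSystem {G : Type*} [Group G] {n : ℕ} (d : Fin n → ℕ)
    (ρ : (k : Fin n) → Representation ℂ G (Fin (d k) → ℂ)) : Prop where
  irreducible : ∀ k, (ρ k).IsIrreducible
  distinct : ∀ i j, Nonempty ((ρ i).Equiv (ρ j)) → i = j
  exhaustive : ∀ (r : ℕ) (σ : Representation ℂ G (Fin r → ℂ)), σ.IsIrreducible →
    ∃ k, Nonempty (σ.Equiv (ρ k))

/-- `cl(g₁), …, cl(gₙ)` are the distinct conjugacy classes of `G`. -/
def IsConjClassSystem {G : Type*} [Group G] {n : ℕ} (g : Fin n → G) : Prop :=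
  Function.Bijective fun k => ConjClasses.mk (g k)

/-- The character table `Q = [χ_i(g_j)]`. -/
def characterTable {G : Type*} [Group G] {n : ℕ} {d : Fin n → ℕ}
    (ρ : (k : Fin n) → Representation ℂ G (Fin (d k) → ℂ)) (g : Fin n → G) :
    Matrix (Fin n) (Fin n) ℂ :=
  Matrix.of fun i j => (ρ i).character (g j)

/-- The character table viewed as the real matrix `Re Q`. -/
def realCharacterTable {G : Type*} [Group G] {n : ℕ} {d : Fin n → ℕ}
    (ρ : (k : Fin n) → Representation ℂ G (Fin (d k) → ℂ)) (g : Fin n → G) :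
    Matrix (Fin n) (Fin n) ℝ :=
  (characterTable ρ g).map Complex.re

/-- The matrix `D_{v⁻¹} Q` with `v = Q e₁`, where `v⁻¹` is the entrywise inverse. -/
def columnNormalized {m : ℕ} {𝕜 : Type*} [RCLike 𝕜]
    (Q : Matrix (Fin (m + 1)) (Fin (m + 1)) 𝕜) : Matrix (Fin (m + 1)) (Fin (m + 1)) 𝕜 :=
  Matrix.diagonal (Q.mulVec (Pi.single 0 1))⁻¹ * Q

/-- `T ⊆ ℝ^m` is an `m`-simplex: the convex hull of `m + 1` affinely independent points. -/
def IsFullSimplex {m : ℕ} (T : Set (Fin m → ℝ)) : Prop :=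
  ∃ p : Fin (m + 1) → (Fin m → ℝ), AffineIndependent ℝ p ∧ T = convexHull ℝ (Set.range p)

end

/-! Let S = D_{v⁻¹}Q. Its first column is all ones, and the trivial representation gives a row of
ones. In that row, M_x(S) reads w = xS⁻¹, so a point x = wS of the spectratope is a convex
combination of the rows of S. Conversely, the rows lie in the spectracone: row orthogonality makes
S⁻¹ explicit, and the entries of M_x(S) at a row x are positive multiples of ∑ χ_i χ_l χ_k over G,
which is |G| times a dimension of invariants. Hence the projected spectratope is the hull of the
rows with their leading 1 deleted (`deleteCoord_image_spectratope`). Its volume is |det S|/m!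
(`volume_convexHull_range_eq_det`), where |det S| = |det Q|/∏ d_k and (det Q)² = ∏ |C_G(g_k)|
(`det_realCharacterTable_sq`). As det S ≠ 0, the vertices are affinely independent. -/

/-! ### Volumes of simplices -/

open MeasureTheory Matrix in
/-- Volume of the corner simplex `{y ≥ 0, ∑ y ≤ r}`. -/
theorem volume_cornerSimplex (m : ℕ) (r : ℝ) :
    volume {y : Fin m → ℝ | (∀ i, 0 ≤ y i) ∧ ∑ i, y i ≤ r} =
      (Set.Ici 0).indicator (fun r : ℝ => ENNReal.ofReal (r ^ m / m.factorial)) r := by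
  -- Fubini in the first coordinate: the slice at t ≥ 0 is the same set with bound r - t. For a
  -- negative bound it is empty, which the polynomial does not see; hence the indicator.
  induction m generalizing r with
  | zero =>
    by_cases hr : 0 ≤ r
    · simp [hr, volume_pi]
    · simp [hr]
  | succ m ih =>
    have hmeas : MeasurableSet {z : ℝ × (Fin m → ℝ) | (0 ≤ z.1 ∧ 0 ≤ z.2) ∧
        z.1 + ∑ i, z.2 i ≤ r} := by
      apply IsClosed.measurableSet
      exact ((isClosed_le continuous_const continuous_fst).inter
        (isClosed_le continuous_const continuous_snd)).inter
          (isClosed_le (f := fun z : ℝ × (Fin m → ℝ) => z.1 + ∑ i, z.2 i) (g := fun _ => r)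
            (by fun_prop) continuous_const)
    have h := (volume_preserving_piFinSuccAbove (fun _ : Fin (m + 1) => ℝ) 0).measure_preimage
      hmeas.nullMeasurableSet
    have hset : {y : Fin (m + 1) → ℝ | (∀ i, 0 ≤ y i) ∧ ∑ i, y i ≤ r} =
        (MeasurableEquiv.piFinSuccAbove (fun _ : Fin (m + 1) => ℝ) 0) ⁻¹'
          {z : ℝ × (Fin m → ℝ) | (0 ≤ z.1 ∧ 0 ≤ z.2) ∧ z.1 + ∑ i, z.2 i ≤ r} := by
      ext y
      simp [Pi.le_def, Fin.forall_fin_succ, Fin.sum_univ_succ, MeasurableEquiv.piFinSuccAbove,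
        Fin.insertNthEquiv, Fin.tail]
    rw [hset, h, Measure.volume_eq_prod, Measure.prod_apply hmeas]
    have hslice : ∀ t : ℝ, volume (Prod.mk t ⁻¹' {z : ℝ × (Fin m → ℝ) |
        (0 ≤ z.1 ∧ 0 ≤ z.2) ∧ z.1 + ∑ i, z.2 i ≤ r}) =
        (Set.Icc 0 r).indicator
          (fun t => ENNReal.ofReal ((r - t) ^ m / m.factorial)) t := by
      intro t
      by_cases ht : 0 ≤ t
      · have : Prod.mk t ⁻¹' {z : ℝ × (Fin m → ℝ) |
            (0 ≤ z.1 ∧ 0 ≤ z.2) ∧ z.1 + ∑ i, z.2 i ≤ r} =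
            {y : Fin m → ℝ | (∀ i, 0 ≤ y i) ∧ ∑ i, y i ≤ r - t} := by
          ext y
          simp [ht, Pi.le_def, le_sub_iff_add_le']
        rw [this, ih]
        by_cases htr : t ≤ r
        · simp [ht, htr]
        · simp [htr]
      · have : Prod.mk t ⁻¹' {z : ℝ × (Fin m → ℝ) |
            (0 ≤ z.1 ∧ 0 ≤ z.2) ∧ z.1 + ∑ i, z.2 i ≤ r} = ∅ := by
          ext y
          simp [ht]
        rw [this]
        simp [ht]
    simp_rw [hslice]
    rw [lintegral_indicator measurableSet_Icc]
    by_cases hr : 0 ≤ r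
    · have hint : ∫ t in (0 : ℝ)..r, (r - t) ^ m / m.factorial =
          r ^ (m + 1) / (m + 1).factorial := by
        rw [intervalIntegral.integral_comp_sub_left (fun t => t ^ m / (m.factorial : ℝ)),
          intervalIntegral.integral_div, integral_pow, Nat.factorial_succ]
        push_cast
        simp [div_div]
      rw [← ofReal_integral_eq_lintegral_ofReal, integral_Icc_eq_integral_Ioc,
        ← intervalIntegral.integral_of_le hr, hint]
      · simp [hr]
      · exact (by fun_prop : Continuous fun t : ℝ => (r - t) ^ m / (m.factorial : ℝ)).integrableOn_Icc
      · filter_upwards [ae_restrict_mem measurableSet_Icc] with t ht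
        have : 0 ≤ r - t := sub_nonneg.2 ht.2
        simp only [Pi.zero_apply]
        positivity
    · simp [hr]

theorem mem_convexHull_range_iff_exists_sum {ι E : Type*} [Fintype ι] [AddCommGroup E]
    [Module ℝ E] (p : ι → E) (x : E) :
    x ∈ convexHull ℝ (Set.range p) ↔
      ∃ w : ι → ℝ, (∀ i, 0 ≤ w i) ∧ ∑ i, w i = 1 ∧ ∑ i, w i • p i = x := by
  classical
  have hp : Set.range p =
      Fintype.linearCombination ℝ p '' Set.range fun i : ι => (Pi.single i 1 : ι → ℝ) := by
    rw [← Set.range_comp]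
    congr 1
    ext i
    simp
  rw [hp, ← LinearMap.image_convexHull, convexHull_rangle_single_eq_stdSimplex]
  simp [stdSimplex, Fintype.linearCombination_apply, and_assoc]

open MeasureTheory in
/-- The volume of the convex hull of `m + 1` points of `ℝ^m`. -/
theorem volume_convexHull_range_eq_det {m : ℕ} (p : Fin (m + 1) → Fin m → ℝ) :
    volume (convexHull ℝ (Set.range p)) =
      ENNReal.ofReal
        (|(Matrix.of fun i => (Fin.cons 1 (p i) : Fin (m + 1) → ℝ)).det| / m.factorial) := by
  set B : Matrix (Fin m) (Fin m) ℝ := Matrix.of fun i j => p i.succ j - p 0 j with hB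
  have hdet : (Matrix.of fun i => (Fin.cons 1 (p i) : Fin (m + 1) → ℝ)).det = B.det := by
    -- Subtracting row 0 from the others leaves a single 1 in column 0, along which the determinant
    -- is expanded.
    rw [Matrix.det_eq_of_forall_row_eq_smul_add_const
      (B := Matrix.of fun i => (Fin.cons (if i = 0 then 1 else 0)
        (if i = 0 then p 0 else p i - p 0) : Fin (m + 1) → ℝ))
      (fun i => if i = 0 then 0 else 1) 0 (by simp)]
    · rw [Matrix.det_succ_column_zero, Fin.sum_univ_succ]
      simp only [Matrix.of_apply, Fin.cons_zero, Fin.succ_ne_zero, if_false, mul_zero, zero_mul,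
        Finset.sum_const_zero, add_zero]
      simp only [if_true, Fin.val_zero, pow_zero, one_mul]
      congr 1
    · intro i j
      refine Fin.cases ?_ (fun j => ?_) j <;> refine Fin.cases ?_ (fun i => ?_) i <;> simp
  -- The weight of `p 0` is the slack 1 - ∑ y, so the hull is an affine image of the corner simplex.
  have hset : convexHull ℝ (Set.range p) =
      (fun x => p 0 + x) '' (Matrix.toLin' B.transpose ''
        {y : Fin m → ℝ | (∀ i, 0 ≤ y i) ∧ ∑ i, y i ≤ 1}) := by
    have key : ∀ y : Fin m → ℝ, p 0 + Matrix.toLin' B.transpose y =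
        (1 - ∑ i, y i) • p 0 + ∑ i : Fin m, y i • p i.succ := by
      intro y
      ext j
      simp [hB, Matrix.mulVec, dotProduct, mul_sub, sub_mul, Finset.sum_mul,
        Finset.sum_sub_distrib, mul_comm]
      ring
    ext x
    rw [mem_convexHull_range_iff_exists_sum, Set.image_image]
    constructor
    · rintro ⟨w, hw0, hw1, rfl⟩
      rw [Fin.sum_univ_succ] at hw1
      refine ⟨fun i => w i.succ, ⟨fun i => hw0 _, by linarith [hw0 0]⟩, ?_⟩
      simp only [key]
      rw [Fin.sum_univ_succ]
      congr 2
      linarith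
    · rintro ⟨y, ⟨hy0, hy1⟩, rfl⟩
      refine ⟨Fin.cons (1 - ∑ i, y i) y, ?_, ?_, ?_⟩
      · exact Fin.cases (by simpa using hy1) (by simpa using hy0)
      · simp [Fin.sum_univ_succ]
      · simp only [key]
        simp [Fin.sum_univ_succ]
  rw [hset, Set.image_add_left, measure_preimage_add, Measure.addHaar_image_linearMap,
    volume_cornerSimplex, LinearMap.det_toLin', Matrix.det_transpose, hdet,
    Set.indicator_of_mem (by simp), ← ENNReal.ofReal_mul (abs_nonneg _)]
  simp [div_eq_mul_inv]

theorem affineIndependent_of_det_ne_zero {m : ℕ} (p : Fin (m + 1) → Fin m → ℝ)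
    (h : (Matrix.of fun i => (Fin.cons 1 (p i) : Fin (m + 1) → ℝ)).det ≠ 0) :
    AffineIndependent ℝ p := by
  rw [affineIndependent_iff_of_fintype]
  intro w hw0 hw
  rw [Finset.weightedVSub_eq_linear_combination _ hw0] at hw
  have hz := Matrix.eq_zero_of_vecMul_eq_zero h (v := w) <| by
    ext j
    refine Fin.cases ?_ (fun j => ?_) j
    · simpa [Matrix.vecMul, dotProduct] using hw0
    · simpa [Matrix.vecMul, dotProduct] using congrFun hw j
  exact fun i => congrFun hz i

/-! ### Characters of finite groups -/

open Matrix in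
/-- Character values at inverses are complex conjugates. -/
theorem Representation.char_inv_eq_star {G : Type*} [Group G] [Finite G] {d : ℕ}
    (ρ : Representation ℂ G (Fin d → ℂ)) (g : G) :
    ρ.character g⁻¹ = star (ρ.character g) := by
  classical
  have := Fintype.ofFinite G
  set M : G → Matrix (Fin d) (Fin d) ℂ := fun g => LinearMap.toMatrix' (ρ g) with hM
  have hmul : ∀ a b, M (a * b) = M a * M b := fun a b => by
    simp [hM, Module.End.mul_eq_comp, LinearMap.toMatrix'_comp]
  have hone : M 1 = 1 := by simp [hM, Module.End.one_eq_id]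
  have htr : ∀ a, ρ.character a = (M a).trace := fun a => by
    rw [Representation.character, LinearMap.trace_eq_matrix_trace ℂ (Pi.basisFun ℂ (Fin d))]
    rfl
  -- The averaged Hermitian form is invariant, so (M g)ᴴ is conjugate to M g⁻¹ and has the same
  -- trace.
  set H : Matrix (Fin d) (Fin d) ℂ := ∑ a, (M a)ᴴ * M a with hH
  have hinv : (M g)ᴴ * H * M g = H := by
    rw [hH, Finset.mul_sum, Finset.sum_mul]
    refine Fintype.sum_equiv (Equiv.mulRight g) _ _ fun a => ?_
    simp [hmul, Matrix.mul_assoc]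
  have hpos : H.PosDef := by
    rw [hH, ← Finset.add_sum_erase _ _ (Finset.mem_univ (1 : G)), hone]
    refine PosDef.add_posSemidef (by simpa using PosDef.one) ?_
    exact Matrix.posSemidef_sum _ fun a _ => posSemidef_conjTranspose_mul_self _
  have hu : IsUnit H.det := (Matrix.isUnit_iff_isUnit_det _).1 hpos.isUnit
  have hgi : M g * M g⁻¹ = 1 := by rw [← hmul, mul_inv_cancel, hone]
  have hconj : (M g)ᴴ = H * M g⁻¹ * H⁻¹ := by
    have h1 : (M g)ᴴ * H = H * M g⁻¹ := by
      conv_rhs => rw [← hinv]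
      rw [Matrix.mul_assoc _ (M g), hgi, Matrix.mul_one]
    rw [← h1, Matrix.mul_nonsing_inv_cancel_right _ _ hu]
  rw [htr, htr, ← Matrix.trace_conjTranspose, hconj, Matrix.trace_mul_comm, ← Matrix.mul_assoc,
    Matrix.nonsing_inv_mul _ hu, Matrix.one_mul]

/-- The trivial representation on a line is irreducible. -/
theorem Representation.isIrreducible_trivial_fin_one (G : Type*) [Group G] :
    (Representation.trivial ℂ G (Fin 1 → ℂ)).IsIrreducible := by
  have hs : IsSimpleOrder (Submodule ℂ (Fin 1 → ℂ)) :=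
    (isSimpleModule_iff ..).1 (isSimpleModule_iff_finrank_eq_one.2 (by simp))
  refine { exists_pair_ne := ⟨⊥, ⊤, fun h => ?_⟩, eq_bot_or_eq_top := fun W => ?_ }
  · have := congrArg Subrepresentation.toSubmodule h
    exact bot_ne_top this
  · rcases hs.eq_bot_or_eq_top W.toSubmodule with h | h
    · left; exact Subrepresentation.toSubmodule_injective h
    · right; exact Subrepresentation.toSubmodule_injective h

/-- The average of a product of three characters is a natural number. -/
theorem Representation.exists_nat_sum_char_mul_char_mul_char {G : Type*} [Group G] [Fintype G]
    {U V W : Type*} [AddCommGroup U] [Module ℂ U] [FiniteDimensional ℂ U] [AddCommGroup V]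
    [Module ℂ V] [FiniteDimensional ℂ V] [AddCommGroup W] [Module ℂ W] [FiniteDimensional ℂ W]
    (ρ : Representation ℂ G U) (σ : Representation ℂ G V) (τ : Representation ℂ G W) :
    ∃ k : ℕ, ∑ a, ρ.character a * σ.character a * τ.character a = Nat.card G * k := by
  have hG : (Nat.card G : ℂ) ≠ 0 := by simp
  have := invertibleOfNonzero hG
  refine ⟨Module.finrank ℂ ((ρ.tprod σ).tprod τ).invariants, ?_⟩
  rw [← Representation.card_inv_mul_sum_char_eq_finrank, mul_inv_cancel_left₀ hG]
  simp [Representation.char_tensor]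

theorem card_centralizer_mul_card_conjClass {G : Type*} [Group G] [Finite G] (g : G) :
    Nat.card (Subgroup.centralizer {g}) * Nat.card (ConjClasses.mk g).carrier = Nat.card G := by
  rw [Subgroup.nat_card_centralizer_nat_card_stabilizer, ← ConjAct.orbit_eq_carrier_conjClasses,
    mul_comm, ← Nat.card_prod,
    Nat.card_congr (MulAction.orbitProdStabilizerEquivGroup (ConjAct G) g)]
  exact Nat.card_congr ConjAct.ofConjAct.toEquiv

/-- Summation of a class function over a system of representatives of the conjugacy classes. -/
theorem IsConjClassSystem.sum_eq {G : Type*} [Group G] [Fintype G] {n : ℕ} {g : Fin n → G}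
    (hg : IsConjClassSystem g) {R : Type*} [NonAssocSemiring R] (f : G → R)
    (hf : ∀ a b, IsConj a b → f a = f b) :
    ∑ a, f a = ∑ j, (Nat.card (ConjClasses.mk (g j)).carrier : R) * f (g j) := by
  classical
  rw [← Finset.sum_fiberwise_of_maps_to (t := Finset.univ) (g := ConjClasses.mk) (by simp),
    ← hg.sum_comp]
  refine Finset.sum_congr rfl fun j _ => ?_
  rw [Finset.sum_congr rfl (g := fun _ => f (g j)) fun a ha => ?_]
  · rw [Finset.sum_const, nsmul_eq_mul]
    congr 2
    rw [← Fintype.card_subtype, ← Nat.card_eq_fintype_card]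
    exact Nat.card_congr (Equiv.subtypeEquivRight fun a => ConjClasses.mem_carrier_iff_mk_eq.symm)
  · exact hf _ _ (ConjClasses.mk_eq_mk_iff_isConj.1 (by simpa using ha))

/-! ### Spectratopes as convex hulls of rows -/

theorem spectralMatrix_apply {n : ℕ} {𝕜 : Type*} [RCLike 𝕜] (S : Matrix (Fin n) (Fin n) 𝕜)
    (x : Fin n → 𝕜) (i k : Fin n) :
    spectralMatrix S x i k = ∑ j, S i j * x j * S⁻¹ j k := by
  rw [spectralMatrix, Matrix.mul_apply]
  simp only [Matrix.mul_diagonal]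

/-- If an invertible matrix has a column and a row of ones and its rows lie in its spectracone, then
its projected spectratope is the convex hull of its projected rows. -/
theorem deleteCoord_image_spectratope {m : ℕ} (S : Matrix (Fin (m + 1)) (Fin (m + 1)) ℝ)
    (hdet : IsUnit S.det) (hcol : ∀ i, S i 0 = 1) (i₀ : Fin (m + 1)) (hrow : ∀ j, S i₀ j = 1)
    (hS : ∀ l, S l ∈ spectracone S) :
    deleteCoord 0 '' spectratope S =
      convexHull ℝ (Set.range fun i => deleteCoord 0 (S i)) := by
  have hproj : ∀ w : Fin (m + 1) → ℝ,
      ∑ i, w i • deleteCoord 0 (S i) = deleteCoord 0 (Matrix.vecMul w S) := fun w => by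
    ext j
    simp [deleteCoord, Matrix.vecMul, dotProduct]
  have hinv : Matrix.mulVec S⁻¹ 1 = Pi.single 0 1 := by
    have h1 : (1 : Fin (m + 1) → ℝ) = Matrix.mulVec S (Pi.single 0 1) := by
      ext i
      simp [hcol]
    rw [h1, Matrix.mulVec_mulVec, Matrix.nonsing_inv_mul _ hdet, Matrix.one_mulVec]
  ext z
  rw [mem_convexHull_range_iff_exists_sum]
  constructor
  · rintro ⟨x, ⟨hx0, hx1⟩, rfl⟩
    have hw : ∀ k, Matrix.vecMul x S⁻¹ k = spectralMatrix S x i₀ k := fun k => by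
      simp [spectralMatrix_apply, hrow, Matrix.vecMul, dotProduct]
    refine ⟨Matrix.vecMul x S⁻¹, fun k => ?_, ?_, ?_⟩
    · rw [hw]
      exact hx0 i₀ k
    · simp_rw [hw]
      simpa [Matrix.mulVec, dotProduct] using congrFun hx1 i₀
    · rw [hproj, Matrix.vecMul_vecMul, Matrix.nonsing_inv_mul _ hdet, Matrix.vecMul_one]
  · rintro ⟨w, hw0, hw1, rfl⟩
    refine ⟨Matrix.vecMul w S, ⟨fun i k => ?_, ?_⟩, (hproj w).symm⟩
    · have : spectralMatrix S (Matrix.vecMul w S) i k =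
          ∑ l, w l * spectralMatrix S (S l) i k := by
        simp only [spectralMatrix_apply, Matrix.vecMul, dotProduct, Finset.mul_sum, Finset.sum_mul]
        rw [Finset.sum_comm]
        exact Finset.sum_congr rfl fun l _ => Finset.sum_congr rfl fun j _ => by ring
      rw [this]
      exact Finset.sum_nonneg fun l _ => mul_nonneg (hw0 l) (hS l i k)
    -- S⁻¹e = e₁, so M_x e is x₀ times the column of ones, and x₀ = ∑ w = 1.
    · rw [spectralMatrix, ← Matrix.mulVec_mulVec, hinv, ← Matrix.mulVec_mulVec]
      ext i
      simp [Matrix.mulVec, dotProduct, Matrix.diagonal_apply, hcol, Matrix.vecMul, hw1,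
        Pi.single_apply]

/-! ### Orthogonality and positivity for real character tables -/

section CharacterTable

variable {G : Type*} [Group G] {n : ℕ} {d : Fin n → ℕ}
  {ρ : (k : Fin n) → Representation ℂ G (Fin (d k) → ℂ)} {g : Fin n → G}

theorem ofReal_realCharacterTable (hreal : ∀ i j, (characterTable ρ g i j).im = 0)
    (i j : Fin n) : (realCharacterTable ρ g i j : ℂ) = (ρ i).character (g j) :=
  Complex.ext rfl (hreal i j).symm

theorem character_eq_of_isConj {V : Type*} [AddCommGroup V] [Module ℂ V]
    (σ : Representation ℂ G V) {a b : G} (h : IsConj a b) : σ.character a = σ.character b := by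
  obtain ⟨c, rfl⟩ := isConj_iff.1 h
  exact (σ.char_conj a c).symm

theorem IsIrrepSystem.sum_char_mul_char_inv [Fintype G] (hρ : IsIrrepSystem d ρ) (i k : Fin n) :
    ∑ a, (ρ i).character a * (ρ k).character a⁻¹ = if i = k then (Nat.card G : ℂ) else 0 := by
  classical
  have hG : (Nat.card G : ℂ) ≠ 0 := by simp
  have := invertibleOfNonzero hG
  have := hρ.irreducible i
  have := hρ.irreducible k
  have h := Representation.char_orthonormal (ρ i) (ρ k)
  rw [inv_mul_eq_iff_eq_mul₀ hG] at h
  rw [h]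
  by_cases hik : i = k
  · subst hik
    simp [show Nonempty ((ρ i).Equiv (ρ i)) from ⟨.refl _⟩]
  · rw [if_neg hik, if_neg fun hne => hik (hρ.distinct _ _ hne).symm, mul_zero]

theorem IsIrrepSystem.dim_ne_zero [Finite G] (hρ : IsIrrepSystem d ρ) (k : Fin n) : d k ≠ 0 := by
  have := Fintype.ofFinite G
  intro hk
  have : IsEmpty (Fin (d k)) := by rw [hk]; infer_instance
  -- On a zero space the character vanishes, but its norm sum is |G|.
  have h := hρ.sum_char_mul_char_inv k k
  simp [Representation.character, Subsingleton.elim ((ρ k) _) 0] at h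
  exact Fintype.card_ne_zero (Nat.cast_eq_zero.1 h.symm)

theorem IsIrrepSystem.exists_character_eq_one (hρ : IsIrrepSystem d ρ) :
    ∃ k, ∀ a, (ρ k).character a = 1 := by
  obtain ⟨k, ⟨e⟩⟩ := hρ.exhaustive 1 (Representation.trivial ℂ G (Fin 1 → ℂ))
    (Representation.isIrreducible_trivial_fin_one G)
  refine ⟨k, fun a => ?_⟩
  rw [← Representation.char_iso e]
  simp [Representation.character]

/-- Row orthogonality for a real character table. -/
theorem realCharacterTable_mul_diagonal_mul_transpose [Finite G] (hρ : IsIrrepSystem d ρ)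
    (hg : IsConjClassSystem g) (hreal : ∀ i j, (characterTable ρ g i j).im = 0) :
    realCharacterTable ρ g *
      (Matrix.diagonal (fun j => (Nat.card (ConjClasses.mk (g j)).carrier : ℝ)) *
        (realCharacterTable ρ g).transpose) = (Nat.card G : ℝ) • 1 := by
  have := Fintype.ofFinite G
  ext i k
  have h := hρ.sum_char_mul_char_inv i k
  rw [hg.sum_eq (fun a => (ρ i).character a * (ρ k).character a⁻¹) fun a b hab => ?_] at h
  · simp only [Representation.char_inv_eq_star, ← ofReal_realCharacterTable hreal,
      Complex.star_def, Complex.conj_ofReal] at h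
    have hR : ∑ j, (Nat.card (ConjClasses.mk (g j)).carrier : ℝ) *
        (realCharacterTable ρ g i j * realCharacterTable ρ g k j) =
        if i = k then (Nat.card G : ℝ) else 0 := by
      apply Complex.ofReal_injective
      split_ifs at h ⊢ <;> exact_mod_cast h
    rw [Matrix.smul_apply, Matrix.one_apply, smul_eq_mul, mul_ite, mul_one, mul_zero, ← hR,
      Matrix.mul_apply]
    refine Finset.sum_congr rfl fun j _ => ?_
    rw [Matrix.diagonal_mul, Matrix.transpose_apply]
    ring
  · have hab' : IsConj a⁻¹ b⁻¹ := by
      obtain ⟨c, rfl⟩ := isConj_iff.1 hab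
      exact isConj_iff.2 ⟨c, by group⟩
    simp only [character_eq_of_isConj _ hab, character_eq_of_isConj _ hab']

/-- The sum is |G| times the dimension of the invariants of a triple tensor product; this puts the
rows in the spectracone. -/
theorem sum_card_mul_realCharacterTable_nonneg [Finite G] (hg : IsConjClassSystem g) (hreal : ∀ i j, (characterTable ρ g i j).im = 0) (i k l : Fin n) :
    0 ≤ ∑ j, (Nat.card (ConjClasses.mk (g j)).carrier : ℝ) * (realCharacterTable ρ g i j *
      realCharacterTable ρ g k j * realCharacterTable ρ g l j) := by
  have := Fintype.ofFinite G
  obtain ⟨N, hN⟩ :=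
    Representation.exists_nat_sum_char_mul_char_mul_char (ρ i) (ρ k) (ρ l)
  rw [hg.sum_eq _ fun a b hab => by simp only [character_eq_of_isConj _ hab]] at hN
  simp only [← ofReal_realCharacterTable hreal] at hN
  have : ∑ j, (Nat.card (ConjClasses.mk (g j)).carrier : ℝ) * (realCharacterTable ρ g i j *
      realCharacterTable ρ g k j * realCharacterTable ρ g l j) = Nat.card G * N := by
    exact_mod_cast hN
  rw [this]
  positivity

/-- Column orthogonality, at the level of determinants. -/
theorem det_realCharacterTable_sq [Finite G] (hρ : IsIrrepSystem d ρ)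
    (hg : IsConjClassSystem g) (hreal : ∀ i j, (characterTable ρ g i j).im = 0) :
    (realCharacterTable ρ g).det ^ 2 =
      ∏ k, (Nat.card (Subgroup.centralizer {g k}) : ℝ) := by
  have h := congrArg Matrix.det (realCharacterTable_mul_diagonal_mul_transpose hρ hg hreal)
  have hc : ∏ j, (Nat.card (ConjClasses.mk (g j)).carrier : ℝ) ≠ 0 := by
    refine Finset.prod_ne_zero_iff.2 fun j _ hj => ?_
    have := card_centralizer_mul_card_conjClass (g j)
    rw [Nat.cast_eq_zero.1 hj, mul_zero] at this
    exact Nat.card_pos.ne this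
  -- One factor |G| = |C_G(g_j)| |cl(g_j)| per class; the class sizes then cancel against det of the
  -- diagonal matrix.
  have hprod : ∏ _j : Fin n, (Nat.card G : ℝ) =
      (∏ k, (Nat.card (Subgroup.centralizer {g k}) : ℝ)) *
        ∏ j, (Nat.card (ConjClasses.mk (g j)).carrier : ℝ) := by
    rw [← Finset.prod_mul_distrib]
    exact Finset.prod_congr rfl fun j _ => by
      rw [← card_centralizer_mul_card_conjClass (g j), Nat.cast_mul]
  rw [Matrix.det_mul, Matrix.det_mul, Matrix.det_diagonal, Matrix.det_transpose, Matrix.det_smul,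
    Matrix.det_one, mul_one, ← Finset.card_univ, ← Finset.prod_const, hprod] at h
  apply mul_right_cancel₀ hc
  rw [← h]
  ring

end CharacterTable

theorem mainTheorem4 {G : Type*} [Group G] [Finite G] {m : ℕ}
    (d : Fin (m + 1) → ℕ)
    (ρ : (k : Fin (m + 1)) → Representation ℂ G (Fin (d k) → ℂ))
    (hρ : IsIrrepSystem d ρ)
    (g : Fin (m + 1) → G) (hg : IsConjClassSystem g) (hg1 : g 0 = 1)
    (hreal : ∀ i j, (characterTable ρ g i j).im = 0) :
    IsFullSimplex (deleteCoord 0 '' spectratope (columnNormalized (realCharacterTable ρ g))) ∧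
    MeasureTheory.volume
        (deleteCoord 0 '' spectratope (columnNormalized (realCharacterTable ρ g))) =
      ENNReal.ofReal
        (√(∏ k, (Nat.card (Subgroup.centralizer {g k}) : ℝ)) /
          ((m.factorial : ℝ) * ∏ k, (d k : ℝ))) := by
  set Q := realCharacterTable ρ g with hQ
  set c : Fin (m + 1) → ℝ := fun j => (Nat.card (ConjClasses.mk (g j)).carrier : ℝ) with hc
  have hdpos : ∀ k, (0 : ℝ) < d k := fun k =>
    Nat.cast_pos.2 (Nat.pos_of_ne_zero (hρ.dim_ne_zero k))
  have hGpos : (0 : ℝ) < Nat.card G := Nat.cast_pos.2 Nat.card_pos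
  have hQ0 : ∀ k, Q k 0 = d k := fun k => by
    apply Complex.ofReal_injective
    rw [hQ, ofReal_realCharacterTable hreal, hg1, Representation.char_one]
    simp
  have hS : ∀ i j, columnNormalized Q i j = (d i : ℝ)⁻¹ * Q i j := fun i j => by
    simp [columnNormalized, Matrix.diagonal_mul, hQ0]
  have horth : Q * (Matrix.diagonal c * Q.transpose) = (Nat.card G : ℝ) • 1 :=
    realCharacterTable_mul_diagonal_mul_transpose hρ hg hreal
  have hdetsq := det_realCharacterTable_sq hρ hg hreal
  have hSQ : columnNormalized Q = Matrix.diagonal (fun k => (d k : ℝ)⁻¹) * Q := by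
    ext i j
    rw [hS, Matrix.diagonal_mul]
  have hSinv : (columnNormalized Q)⁻¹ =
      Matrix.of fun j k => (Nat.card G : ℝ)⁻¹ * c j * Q k j * d k := by
    refine Matrix.inv_eq_right_inv ?_
    have h : (Matrix.of fun j k => (Nat.card G : ℝ)⁻¹ * c j * Q k j * d k) =
        (Nat.card G : ℝ)⁻¹ • (Matrix.diagonal c * Q.transpose) *
          Matrix.diagonal (fun k => (d k : ℝ)) := by
      ext j k
      rw [Matrix.mul_diagonal, Matrix.smul_apply, Matrix.diagonal_mul, Matrix.transpose_apply,
        Matrix.of_apply, smul_eq_mul]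
      ring
    rw [h, hSQ, Matrix.mul_assoc, ← Matrix.mul_assoc Q, Matrix.mul_smul, horth, smul_smul,
      inv_mul_cancel₀ hGpos.ne', one_smul, Matrix.one_mul, Matrix.diagonal_mul_diagonal]
    simp [(hdpos _).ne']
  have hdetS : |(columnNormalized Q).det| =
      √(∏ k, (Nat.card (Subgroup.centralizer {g k}) : ℝ)) / ∏ k, (d k : ℝ) := by
    rw [hSQ, Matrix.det_mul, Matrix.det_diagonal, abs_mul, ← hdetsq, Real.sqrt_sq_eq_abs,
      Finset.prod_inv_distrib, abs_of_pos (inv_pos.2 (Finset.prod_pos fun k _ => hdpos k)),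
      mul_comm, div_eq_mul_inv]
  have hunit : IsUnit (columnNormalized Q).det := by
    rw [isUnit_iff_ne_zero, ← abs_pos, hdetS]
    exact div_pos (Real.sqrt_pos.2 (Finset.prod_pos fun k _ => Nat.cast_pos.2 Nat.card_pos))
      (Finset.prod_pos fun k _ => hdpos k)
  have hcol : ∀ i, columnNormalized Q i 0 = 1 := fun i => by
    rw [hS, hQ0, inv_mul_cancel₀ (hdpos i).ne']
  obtain ⟨i₀, hi₀⟩ := hρ.exists_character_eq_one
  have hQi₀ : ∀ j, Q i₀ j = 1 := fun j => by
    apply Complex.ofReal_injective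
    rw [hQ, ofReal_realCharacterTable hreal, hi₀, Complex.ofReal_one]
  have hrow : ∀ j, columnNormalized Q i₀ j = 1 := fun j => by
    rw [hS, ← hQ0, hQi₀, hQi₀, inv_one, one_mul]
  have hcone : ∀ l, columnNormalized Q l ∈ spectracone (columnNormalized Q) := fun l i k => by
    have : spectralMatrix (columnNormalized Q) (columnNormalized Q l) i k =
        (d i : ℝ)⁻¹ * (d l : ℝ)⁻¹ * (Nat.card G : ℝ)⁻¹ * d k *
          ∑ j, c j * (Q i j * Q l j * Q k j) := by
      rw [spectralMatrix_apply, hSinv, Finset.mul_sum]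
      refine Finset.sum_congr rfl fun j _ => ?_
      rw [hS, hS, Matrix.of_apply]
      ring
    rw [this]
    exact mul_nonneg (by positivity) (sum_card_mul_realCharacterTable_nonneg hg hreal i l k)
  rw [deleteCoord_image_spectratope _ hunit hcol i₀ hrow hcone]
  -- Restoring the deleted leading 1 recovers S, so the simplex determinant is det S.
  have hcons : (Matrix.of fun i => (Fin.cons 1 (deleteCoord 0 (columnNormalized Q i)) :
      Fin (m + 1) → ℝ)) = columnNormalized Q := by
    ext i j
    refine Fin.cases ?_ (fun j => ?_) j
    · simp [hcol]
    · simp [deleteCoord]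
  refine ⟨⟨_, affineIndependent_of_det_ne_zero _ (by rw [hcons]; exact hunit.ne_zero), rfl⟩, ?_⟩
  rw [volume_convexHull_range_eq_det, hcons, hdetS, div_div, mul_comm (∏ k, (d k : ℝ))]
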